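/- Let $N\ge 3$, $\bar\mu=\left(\frac{N-2}{2}\right)^2$, $0<\mu<\bar\mu$, $\nu=\sqrt{\bar\mu}-\sqrt{\bar\mu-\mu}$, and let $p,q$ be real numbers with $p\ge \frac{N+2}{N-2}$ and $q>\max\left\{p,\frac{2+\nu}{\nu}\right\}$. Let $R>0$. Then there are constants $\rho>0$ and $C>0$, depending only on $N,\mu,p,q,R$, such that the following holds. Let $\Omega\subseteq\mathbb R^N$ be a smooth domain (bounded or unbounded) with $B_R(0)\subseteq\Omega$, and let $u$ be a (weak) solution of $$-\Delta u-\mu\frac{u}{|x|^2}=u^p-u^q\ \text{ in }\Omega,\qquad u>0\ \text{ in }\Omega,\qquad u\in H^1_0(\Omega)\cap L^{q+1}(\Omega),$$ that is, $\int_\Omega \nabla u\cdot\nabla\varphi\,dx-\mu\int_\Omega\frac{u\varphi}{|x|^2}\,dx=\int_\Omega(u^p-u^q)\varphi\,dx$ for all $\varphi\in C_c^\infty(\Omega)$. Then $$u(x)\le C|x|^{-\frac{2}{q-1}}\qquad\text{for almost every }x\in B_\rho(0)\setminus\{0\},$$ and, if $u$ is (represented by) a function continuous on $\Omega\setminus\{0\}$,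 for every $x\in B_\rho(0)\setminus\{0\}$. -/

import Mathlib

open MeasureTheory TopologicalSpace
open scoped Distributions ContDiff Gradient ENNReal

namespace HardyProblem

/-- The best Hardy constant `μ̄ = ((N - 2) / 2) ^ 2`. -/
noncomputable def muBar (N : ℕ) : ℝ := (((N : ℝ) - 2) / 2) ^ 2

/-- The exponent `ν = √μ̄ - √(μ̄ - μ)`. -/
noncomputable def nu (N : ℕ) (μ : ℝ) : ℝ := √(muBar N) - √(muBar N - μ)

/-- A smooth domain (bounded or unbounded): a connected open set which near each of its boundary
points `x` is the sublevel set `{g < 0}` of a smooth function `g` with `∇ g x ≠ 0`, `g x = 0`. -/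
def IsSmoothDomain {N : ℕ} (Ω : Opens (EuclideanSpace ℝ (Fin N))) : Prop :=
  IsConnected (Ω : Set (EuclideanSpace ℝ (Fin N))) ∧
    ∀ x ∈ frontier (Ω : Set (EuclideanSpace ℝ (Fin N))),
      ∃ U : Opens (EuclideanSpace ℝ (Fin N)), ∃ g : EuclideanSpace ℝ (Fin N) → ℝ,
        x ∈ U ∧ ContDiffOn ℝ ∞ g U ∧ g x = 0 ∧ ∇ g x ≠ 0 ∧ ∀ y ∈ U, y ∈ Ω ↔ g y < 0

/-- `u` is locally integrable in `Ω` and has the weak gradient `G` there. -/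
def HasWeakGradient {N : ℕ} (Ω : Opens (EuclideanSpace ℝ (Fin N)))
    (u : EuclideanSpace ℝ (Fin N) → ℝ)
    (G : EuclideanSpace ℝ (Fin N) → EuclideanSpace ℝ (Fin N)) : Prop :=
  LocallyIntegrableOn u Ω ∧ LocallyIntegrableOn G Ω ∧
    ∀ φ : 𝓓(Ω, ℝ), ∫ x in Ω, u x • ∇ φ x = -∫ x in Ω, φ x • G x

/-- `u` belongs to `H¹(Ω)` and has the weak gradient `G`. -/
def MemH1 {N : ℕ} (Ω : Opens (EuclideanSpace ℝ (Fin N)))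
    (u : EuclideanSpace ℝ (Fin N) → ℝ)
    (G : EuclideanSpace ℝ (Fin N) → EuclideanSpace ℝ (Fin N)) : Prop :=
  MemLp u 2 (volume.restrict Ω) ∧ MemLp G 2 (volume.restrict Ω) ∧ HasWeakGradient Ω u G

/-- `u`, with weak gradient `G`, belongs to `H¹₀(Ω)`, the closure of `C_c^∞(Ω)` in `H¹(Ω)`. -/
def MemH10 {N : ℕ} (Ω : Opens (EuclideanSpace ℝ (Fin N)))
    (u : EuclideanSpace ℝ (Fin N) → ℝ)
    (G : EuclideanSpace ℝ (Fin N) → EuclideanSpace ℝ (Fin N)) : Prop :=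
  MemH1 Ω u G ∧ ∀ ε : ℝ≥0∞, 0 < ε → ∃ φ : 𝓓(Ω, ℝ),
    eLpNorm (fun x => φ x - u x) 2 (volume.restrict Ω) < ε ∧
      eLpNorm (fun x => ∇ φ x - G x) 2 (volume.restrict Ω) < ε

/-- `u` is a weak solution of `-Δ u - μ u / |x|² = u ^ p - u ^ q` in `Ω`, `u > 0` in `Ω`,
`u ∈ H¹₀(Ω) ∩ L^{q+1}(Ω)`. Only the almost everywhere class of `u` in `Ω` matters. -/
def IsSolution {N : ℕ} (μ p q : ℝ) (Ω : Opens (EuclideanSpace ℝ (Fin N)))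
    (u : EuclideanSpace ℝ (Fin N) → ℝ) : Prop :=
  (∀ᵐ x ∂(volume.restrict (Ω : Set (EuclideanSpace ℝ (Fin N)))), 0 < u x) ∧
    MemLp u (ENNReal.ofReal (q + 1)) (volume.restrict Ω) ∧
    ∃ G : EuclideanSpace ℝ (Fin N) → EuclideanSpace ℝ (Fin N), MemH10 Ω u G ∧
      ∀ φ : 𝓓(Ω, ℝ),
        (∫ x in Ω, inner ℝ (G x) (∇ φ x)) - μ * (∫ x in Ω, u x / ‖x‖ ^ 2 * φ x) =
          ∫ x in Ω, (u x ^ p - u x ^ q) * φ x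

end HardyProblem

/-!
The bound is an interior Keller–Osserman estimate on the balls `B(x₀, |x₀| / 2)`, which stay away from
the singularity of the potential. On such a ball, with `r = |x₀| / 4 ≤ 1`, the terms
`μ u / |x|² + u ^ p` are absorbed by half of `u ^ q` up to an error `K r ^ (-2q/(q-1))`
(`exists_absorption_const`), so that `Δu ≥ u ^ q / 2 - K r ^ (-2q/(q-1))` weakly.

No regularity of `u` is needed. The equation is tested with translates of a mollifier; by Jensen's
inequality the mollification `v` satisfies the same differential inequality, now in the classical
sense (`IsSolution.laplacian_mollification_ge`). Since `v` is bounded on `B(x₀, r)`, it can be touched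
from above by a multiple of the barrier `(r² - |x - x₀|²) ^ (-2/(q-1))`, which is infinite on the
boundary, and the second derivative test at the touching point bounds the multiple. This gives
`v x₀ ≤ B r ^ (-2/(q-1))` with `B` independent of the mollifier (`exists_kellerOsserman_bound`). When
the mollifier concentrates, `v x₀` tends to `u x₀` at almost every `x₀` by Lebesgue's differentiation
theorem.
-/

namespace HardyProblem

open Filter Topology Metric

/-! ### Absorbing the lower order terms -/

theorem isLittleO_rpow_rpow_atTop {p q : ℝ} (hpq : p < q) :
    (fun s : ℝ => s ^ p) =o[atTop] fun s : ℝ => s ^ q := by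
  refine (Asymptotics.isLittleO_iff_tendsto' ?_).2 ?_
  · filter_upwards [eventually_gt_atTop 0] with s hs h
    exact absurd h (Real.rpow_pos_of_pos hs q).ne'
  · refine (tendsto_rpow_neg_atTop (sub_pos.2 hpq)).congr' ?_
    filter_upwards [eventually_gt_atTop 0] with s hs
    rw [← Real.rpow_sub hs, neg_sub]

theorem exists_forall_lower_order_lt {p q : ℝ} (hq : 1 < q) (hpq : p < q) (c k : ℝ) :
    ∃ L : ℝ, 0 < L ∧ ∀ s, L ≤ s → c * s + s ^ p + k < s ^ q / 2 := by
  have h1 : (fun s : ℝ => c * s) =o[atTop] fun s : ℝ => s ^ q := by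
    simpa using (isLittleO_rpow_rpow_atTop hq).const_mul_left c
  have h2 : (fun s : ℝ => s ^ p) =o[atTop] fun s : ℝ => s ^ q := isLittleO_rpow_rpow_atTop hpq
  have h3 : (fun _ : ℝ => k) =o[atTop] fun s : ℝ => s ^ q := by
    simpa using (isLittleO_rpow_rpow_atTop (zero_lt_one.trans hq)).const_mul_left k
  have h := ((h1.add h2).add h3).bound (show (0 : ℝ) < 1 / 4 by norm_num)
  obtain ⟨L, hL⟩ := eventually_atTop.1 h
  refine ⟨max L 1, by positivity, fun s hs => ?_⟩
  have hs0 : 0 < s := by linarith [le_max_right L 1]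
  have := hL s ((le_max_left _ _).trans hs)
  have hsq : 0 < s ^ q := Real.rpow_pos_of_pos hs0 q
  rw [Real.norm_eq_abs, Real.norm_eq_abs, abs_of_pos hsq] at this
  linarith [le_abs_self (c * s + s ^ p + k)]

/-- The potential and the power `t ^ p` are absorbed by half of `t ^ q`, with an error of the
natural order `r ^ (-2q/(q-1)) = r ^ (-(2/(q-1) + 2))`. The constant does not depend on `r ≤ 1`:
for `t = s * r ^ (-2/(q-1))` the terms in `c` and `q` scale alike, and the one in `p < q` scales
better. -/
theorem exists_absorption_const {p q c : ℝ} (hp : 0 ≤ p) (hq : 1 < q) (hpq : p < q) (hc : 0 ≤ c) :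
    ∃ K : ℝ, 0 ≤ K ∧ ∀ r t : ℝ, 0 < r → r ≤ 1 → 0 ≤ t →
      c * r ^ (-2 : ℝ) * t + (t ^ p - t ^ q) ≤ K * r ^ (-(2 / (q - 1) + 2)) - t ^ q / 2 := by
  obtain ⟨L, hL, h⟩ := exists_forall_lower_order_lt hq hpq c 0
  refine ⟨c * L + L ^ p, by positivity, fun r t hr hr1 ht => ?_⟩
  have hq1 : 0 < q - 1 := by linarith
  set a := 2 / (q - 1) with ha
  have ha0 : 0 < a := by positivity
  have haq : a * q = a + 2 := by rw [ha]; field_simp; ring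
  obtain ⟨s, hs, rfl⟩ : ∃ s, 0 ≤ s ∧ t = s * r ^ (-a) :=
    ⟨t * r ^ a, by positivity, by rw [mul_assoc, ← Real.rpow_add hr]; simp⟩
  have hra : (0 : ℝ) ≤ r ^ (-a) := by positivity
  have e1 : r ^ (-2 : ℝ) * r ^ (-a) = r ^ (-(a + 2)) := by
    rw [← Real.rpow_add hr]; ring_nf
  have e2 : (s * r ^ (-a)) ^ q = s ^ q * r ^ (-(a + 2)) := by
    rw [Real.mul_rpow hs hra, ← Real.rpow_mul hr.le, ← haq]; ring_nf
  have e3 : (s * r ^ (-a)) ^ p ≤ s ^ p * r ^ (-(a + 2)) := by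
    rw [Real.mul_rpow hs hra, ← Real.rpow_mul hr.le, ← haq]
    have : r ^ (-a * p) ≤ r ^ (-(a * q)) :=
      Real.rpow_le_rpow_of_exponent_ge hr hr1 (by nlinarith)
    exact mul_le_mul_of_nonneg_left this (by positivity)
  have key : c * s + s ^ p ≤ s ^ q / 2 + (c * L + L ^ p) := by
    rcases le_total L s with hLs | hLs
    · have : 0 ≤ c * L + L ^ p := by positivity
      linarith [h s hLs]
    · have h1 : s ^ p ≤ L ^ p := Real.rpow_le_rpow hs hLs hp
      have h2 : c * s ≤ c * L := mul_le_mul_of_nonneg_left hLs hc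
      have h3 : 0 ≤ s ^ q := by positivity
      linarith
  have hR : (0 : ℝ) ≤ r ^ (-(a + 2)) := by positivity
  have := mul_le_mul_of_nonneg_right key hR
  have e4 : c * r ^ (-2 : ℝ) * (s * r ^ (-a)) = c * s * r ^ (-(a + 2)) := by rw [← e1]; ring
  rw [e4, e2]
  nlinarith

/-- The convex function `t ↦ t ^ q` lies above its tangent at `s`. Integrated against a probability
density, with `s` the mean, this is Jensen's inequality. -/
theorem rpow_tangent_le {q s t : ℝ} (hq : 1 ≤ q) (hs : 0 < s) (ht : 0 ≤ t) :
    s ^ q + q * s ^ (q - 1) * (t - s) ≤ t ^ q := by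
  have h := one_add_mul_self_le_rpow_one_add (s := t / s - 1) (p := q)
    (by linarith [div_nonneg ht hs.le]) hq
  have hsq : 0 < s ^ q := by positivity
  have h' := mul_le_mul_of_nonneg_left h hsq.le
  have e : s ^ q * (1 + (t / s - 1)) ^ q = t ^ q := by
    rw [← Real.mul_rpow hs.le (by simpa using div_nonneg ht hs.le)]
    congr 1; field_simp; ring
  rw [e] at h'
  refine le_trans (le_of_eq ?_) h'
  rw [Real.rpow_sub_one hs.ne']; field_simp

/-! ### A necessary second derivative test -/

/-- The second derivative test in its necessary form. -/
theorem _root_.IsLocalMax.second_deriv_nonpos {f f' : ℝ → ℝ} {x m : ℝ} (h : IsLocalMax f x)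
    (hf : ∀ᶠ t in 𝓝 x, HasDerivAt f (f' t) t) (hf' : HasDerivAt f' m x) : m ≤ 0 := by
  by_contra! hm
  have e : deriv f =ᶠ[𝓝 x] f' := hf.mono fun t ht => ht.deriv
  have hd : deriv (deriv f) x = m := by rw [e.deriv_eq, hf'.deriv]
  have hmin : IsLocalMin f x := isLocalMin_of_deriv_deriv_pos (by rw [hd]; exact hm)
    h.deriv_eq_zero hf.self_of_nhds.continuousAt
  have hc : f =ᶠ[𝓝 x] fun _ => f x := by
    filter_upwards [h, hmin] with t h1 h2 using le_antisymm h1 h2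
  have : deriv f =ᶠ[𝓝 x] fun _ => 0 := by simpa using hc.deriv
  rw [this.deriv_eq] at hd
  simp at hd
  exact hm.ne hd

/-! ### Partial derivatives -/

variable {N : ℕ}

local notation "𝔼" => EuclideanSpace ℝ (Fin N)

/-- The derivative of `f` in the `i`-th coordinate direction, as a function of the point. -/
noncomputable def partialDeriv (i : Fin N) (f : EuclideanSpace ℝ (Fin N) → ℝ) :
    EuclideanSpace ℝ (Fin N) → ℝ :=
  fun x => fderiv ℝ f x (EuclideanSpace.single i 1)

theorem contDiff_partialDeriv {f : 𝔼 → ℝ} (hf : ContDiff ℝ ∞ f) (i : Fin N) :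
    ContDiff ℝ ∞ (partialDeriv i f) :=
  (hf.fderiv_right (m := ∞) (by simp)).clm_apply contDiff_const

theorem hasCompactSupport_partialDeriv {f : 𝔼 → ℝ} (hf : HasCompactSupport f) (i : Fin N) :
    HasCompactSupport (partialDeriv i f) :=
  hf.fderiv_apply (𝕜 := ℝ) _

theorem tsupport_partialDeriv_subset (f : 𝔼 → ℝ) (i : Fin N) :
    tsupport (partialDeriv i f) ⊆ tsupport f :=
  tsupport_fderiv_apply_subset ℝ _

/-- The partial derivative is the derivative along a coordinate line, at every point of the line. -/
theorem hasDerivAt_line {f : 𝔼 → ℝ} (hf : ContDiff ℝ ∞ f) (i : Fin N) (x : 𝔼) (t : ℝ) :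
    HasDerivAt (fun t : ℝ => f (x + t • EuclideanSpace.single i 1))
      (partialDeriv i f (x + t • EuclideanSpace.single i 1)) t := by
  have h1 : HasFDerivAt f (fderiv ℝ f (x + t • EuclideanSpace.single i 1))
    (x + t • EuclideanSpace.single i 1) := (hf.differentiable (by simp) _).hasFDerivAt
  have h2 : HasDerivAt (fun t : ℝ => x + t • (EuclideanSpace.single i 1 : 𝔼))
      (EuclideanSpace.single i 1) t := by
    simpa using ((hasDerivAt_id t).smul_const (EuclideanSpace.single i 1 : 𝔼)).const_add x
  exact h1.comp_hasDerivAt t h2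

theorem partialDeriv_comp_sub_left {f : 𝔼 → ℝ} (hf : ContDiff ℝ ∞ f) (y : 𝔼) (i : Fin N) :
    partialDeriv i (fun x => f (y - x)) = fun x => -partialDeriv i f (y - x) := by
  funext x
  have h1 : HasFDerivAt f (fderiv ℝ f (y - x)) (y - x) :=
    (hf.differentiable (by simp) _).hasFDerivAt
  have h2 : HasFDerivAt (fun x : 𝔼 => y - x) (-ContinuousLinearMap.id ℝ 𝔼) x :=
    (hasFDerivAt_id x).const_sub y
  have h3 : HasFDerivAt (fun x : 𝔼 => f (y - x)) _ x := h1.comp x h2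
  simp [partialDeriv, h3.fderiv]

theorem partialDeriv_partialDeriv_comp_sub_left {f : 𝔼 → ℝ} (hf : ContDiff ℝ ∞ f) (y : 𝔼)
    (i : Fin N) :
    partialDeriv i (partialDeriv i (fun x => f (y - x))) =
      fun x => partialDeriv i (partialDeriv i f) (y - x) := by
  rw [partialDeriv_comp_sub_left hf]
  have : partialDeriv i (fun x => -partialDeriv i f (y - x)) =
      fun x => -partialDeriv i (fun x => partialDeriv i f (y - x)) x := by
    funext x
    simp only [partialDeriv]
    rw [fderiv_fun_neg]; rfl
  rw [this, partialDeriv_comp_sub_left (contDiff_partialDeriv hf i)]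
  simp

theorem gradient_apply {f : 𝔼 → ℝ} (i : Fin N) (x : 𝔼) :
    (∇ f x) i = partialDeriv i f x := by
  have h : inner ℝ (∇ f x) (EuclideanSpace.single i (1 : ℝ)) = partialDeriv i f x := by
    rw [gradient, InnerProductSpace.toDual_symm_apply, partialDeriv]
  rw [← h, EuclideanSpace.inner_single_right]
  simp

open scoped Convolution in
theorem partialDeriv_convolution {f U : 𝔼 → ℝ} (hf : ContDiff ℝ ∞ f) (hc : HasCompactSupport f)
    (hU : LocallyIntegrable U) (i : Fin N) :
    partialDeriv i (f ⋆[ContinuousLinearMap.lsmul ℝ ℝ, volume] U) =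
      partialDeriv i f ⋆[ContinuousLinearMap.lsmul ℝ ℝ, volume] U := by
  funext x
  have h := hc.hasFDerivAt_convolution_left (μ := volume) (ContinuousLinearMap.lsmul ℝ ℝ)
    (hf.of_le (by simp)) hU x
  rw [partialDeriv, h.fderiv]
  have hex := (hc.fderiv ℝ).convolutionExists_left
    ((ContinuousLinearMap.lsmul ℝ ℝ).precompL 𝔼 : (𝔼 →L[ℝ] ℝ) →L[ℝ] ℝ →L[ℝ] 𝔼 →L[ℝ] ℝ)
    (hf.continuous_fderiv (by simp)) hU x
  simp_rw [convolution_def, ContinuousLinearMap.integral_apply hex]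
  rfl

/-! ### The weak equation tested with a density -/

/-- Integration by parts `∫ u Δφ = -∫ ⟪G, ∇φ⟫`: the weak gradient is tested with the partial
derivatives of `φ`, and the `i`-th component is taken of the identity for `∂ᵢφ`. -/
theorem integral_mul_laplacian {Ω : Opens 𝔼} {u : 𝔼 → ℝ} {G : 𝔼 → 𝔼} (h : MemH1 Ω u G)
    {φ : 𝔼 → ℝ} (hφ : ContDiff ℝ ∞ φ) (hc : HasCompactSupport φ) (hs : tsupport φ ⊆ Ω) :
    ∑ i, ∫ x in Ω, u x * partialDeriv i (partialDeriv i φ) x =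
      -∫ x in Ω, inner ℝ (G x) (∇ φ x) := by
  obtain ⟨hu, hG, -, -, hw⟩ := h
  have hcont : ∀ i, Continuous (partialDeriv i φ) := fun i => (contDiff_partialDeriv hφ i).continuous
  have hL2 : ∀ i, MemLp (partialDeriv i φ) 2 (volume.restrict (Ω : Set 𝔼)) := fun i =>
    ((hcont i).memLp_of_hasCompactSupport (hasCompactSupport_partialDeriv hc i)).restrict _
  have hGi : ∀ i, MemLp (fun x => G x i) 2 (volume.restrict (Ω : Set 𝔼)) := fun i =>
    (EuclideanSpace.proj (𝕜 := ℝ) i).comp_memLp' hG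
  have hint : ∀ i, Integrable (fun x => partialDeriv i φ x * G x i) (volume.restrict (Ω : Set 𝔼)) :=
    fun i => (hL2 i).integrable_mul (hGi i)
  have hin : ∀ x, inner ℝ (G x) (∇ φ x) = ∑ i, partialDeriv i φ x * G x i := fun x => by
    rw [PiLp.inner_apply]
    exact Finset.sum_congr rfl fun i _ => by rw [← gradient_apply]; rfl
  simp_rw [hin]
  rw [integral_finsetSum _ fun i _ => hint i, ← Finset.sum_neg_distrib]
  refine Finset.sum_congr rfl fun i _ => ?_
  have hψ := contDiff_partialDeriv hφ i
  have hψc := hasCompactSupport_partialDeriv hc i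
  have key := hw ⟨partialDeriv i φ, hψ, hψc, (tsupport_partialDeriv_subset φ i).trans hs⟩
  simp only [TestFunction.coe_mk] at key
  have hgcont : Continuous (∇ (partialDeriv i φ)) := by
    have := hψ.continuous_fderiv (by simp)
    exact (InnerProductSpace.toDual ℝ 𝔼).symm.continuous.comp this
  have hgc : HasCompactSupport (∇ (partialDeriv i φ)) :=
    (hψc.fderiv ℝ).comp_left (g := (InnerProductSpace.toDual ℝ 𝔼).symm) (by simp)
  have hg2 : MemLp (∇ (partialDeriv i φ)) 2 (volume.restrict (Ω : Set 𝔼)) :=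
    (hgcont.memLp_of_hasCompactSupport hgc).restrict _
  have i1 : Integrable (fun x => u x • ∇ (partialDeriv i φ) x) (volume.restrict (Ω : Set 𝔼)) :=
    memLp_one_iff_integrable.1 (hg2.smul hu)
  have i2 : Integrable (fun x => partialDeriv i φ x • G x) (volume.restrict (Ω : Set 𝔼)) :=
    memLp_one_iff_integrable.1 (hG.smul (hL2 i))
  have e := congrArg (EuclideanSpace.proj (𝕜 := ℝ) i) key
  rw [map_neg, ← ContinuousLinearMap.integral_comp_comm _ i1,
    ← ContinuousLinearMap.integral_comp_comm _ i2] at e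
  simpa [gradient_apply] using e

/-- If `u ∈ Lᵇ(Ω)`, the powers `u ^ a` with `0 ≤ a ≤ b` are integrable against a
continuous compactly supported function. -/
theorem integrable_rpow_mul {Ω : Opens 𝔼} {u φ : 𝔼 → ℝ} {a b : ℝ} (ha : 0 ≤ a) (hab : a ≤ b)
    (hb : 0 < b) (hpos : ∀ᵐ x ∂(volume.restrict (Ω : Set 𝔼)), 0 < u x)
    (hu : MemLp u (ENNReal.ofReal b) (volume.restrict Ω))
    (hφ : Continuous φ) (hc : HasCompactSupport φ) :
    IntegrableOn (fun x => u x ^ a * φ x) Ω := by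
  have h1 : IntegrableOn (fun x => ‖u x‖ ^ b) Ω := by
    simpa only [ENNReal.toReal_ofReal hb.le, IntegrableOn] using
      hu.integrable_norm_rpow (by simpa using hb) ENNReal.ofReal_ne_top
  obtain ⟨M, hM⟩ := hφ.bounded_above_of_compact_support hc
  have h2 : IntegrableOn φ Ω := (hφ.integrable_of_hasCompactSupport hc).integrableOn
  refine Integrable.mono' (h2.norm.add (h1.mul_const M))
    ((hu.1.aemeasurable.pow_const a).aestronglyMeasurable.mul h2.1) ?_
  filter_upwards [hpos] with x hx
  have hxa : 0 ≤ u x ^ a := by positivity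
  have hxb : 0 ≤ u x ^ b := by positivity
  have hle : u x ^ a ≤ 1 + u x ^ b := by
    rcases le_total (u x) 1 with h | h
    · linarith [Real.rpow_le_one hx.le h ha]
    · linarith [Real.rpow_le_rpow_of_exponent_le h hab]
  simp only [Pi.add_apply, norm_mul, Real.norm_eq_abs, abs_of_nonneg hxa, abs_of_pos hx]
  have hM' : |φ x| ≤ M := hM x
  calc u x ^ a * |φ x| ≤ (1 + u x ^ b) * |φ x| := by gcongr
    _ = |φ x| + u x ^ b * |φ x| := by ring
    _ ≤ _ := by gcongr

/-- The equation tested with a probability density `φ` supported at distance at least `r` from the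
origin. The nonlinearity is bounded above pointwise by an affine function of `u`, the tangent of
`-t ^ q / 2` at the mean `∫ u φ` plus an error, whose integral against `φ` is explicit. -/
theorem IsSolution.le_integral_mul_laplacian {μ p q K r : ℝ} {Ω : Opens 𝔼} {u : 𝔼 → ℝ}
    (hsol : IsSolution μ p q Ω u) (hμ : 0 ≤ μ) (hp : 0 ≤ p) (hq : 1 < q) (hpq : p < q)
    (hr : 0 < r) (hr1 : r ≤ 1)
    (hK : ∀ r t : ℝ, 0 < r → r ≤ 1 → 0 ≤ t →
      μ * r ^ (-2 : ℝ) * t + (t ^ p - t ^ q) ≤ K * r ^ (-(2 / (q - 1) + 2)) - t ^ q / 2)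
    {φ : 𝔼 → ℝ} (hφ : ContDiff ℝ ∞ φ) (hc : HasCompactSupport φ) (hs : tsupport φ ⊆ Ω)
    (hφ0 : ∀ x, 0 ≤ φ x) (hφr : ∀ x ∈ tsupport φ, r ≤ ‖x‖) (hφ1 : ∫ x in Ω, φ x = 1)
    (hpos : 0 < ∫ x in Ω, u x * φ x) :
    (∫ x in Ω, u x * φ x) ^ q / 2 - K * r ^ (-(2 / (q - 1) + 2)) ≤
      ∑ i, ∫ x in Ω, u x * partialDeriv i (partialDeriv i φ) x := by
  obtain ⟨hu0, huq, G, ⟨hH, -⟩, heq⟩ := hsol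
  rw [integral_mul_laplacian hH hφ hc hs]
  have hE := heq ⟨φ, hφ, hc, hs⟩
  simp only [TestFunction.coe_mk] at hE
  set s := ∫ x in Ω, u x * φ x with hs_def
  have hcont := hφ.continuous
  have iφ : IntegrableOn φ Ω := (hcont.integrable_of_hasCompactSupport hc).integrableOn
  have ip := integrable_rpow_mul hp (by linarith) (by linarith) hu0 huq hcont hc
  have iq :=
    integrable_rpow_mul (zero_le_one.trans hq.le) (by linarith) (by linarith) hu0 huq hcont hc
  have i1 : IntegrableOn (fun x => u x * φ x) Ω := by
    simpa using integrable_rpow_mul zero_le_one (by linarith) (by linarith) hu0 huq hcont hc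
  have ipq : IntegrableOn (fun x => (u x ^ p - u x ^ q) * φ x) Ω := by
    simp_rw [sub_mul]; exact ip.sub iq
  have hbd : ∀ x, 0 < u x → μ * (u x / ‖x‖ ^ 2 * φ x) ≤ μ * r ^ (-2 : ℝ) * (u x * φ x) ∧
      ‖u x / ‖x‖ ^ 2 * φ x‖ ≤ r ^ (-2 : ℝ) * (u x * φ x) := fun x hx => by
    have key : u x / ‖x‖ ^ 2 * φ x ≤ r ^ (-2 : ℝ) * (u x * φ x) := by
      by_cases hxs : x ∈ tsupport φ
      · have : (‖x‖ ^ 2)⁻¹ ≤ r ^ (-2 : ℝ) := by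
          rw [Real.rpow_neg hr.le, Real.rpow_two]
          have := hφr x hxs
          gcongr
        rw [div_eq_inv_mul, mul_assoc]
        exact mul_le_mul_of_nonneg_right this (mul_nonneg hx.le (hφ0 x))
      · simp [image_eq_zero_of_notMem_tsupport hxs]
    refine ⟨by rw [mul_assoc]; exact mul_le_mul_of_nonneg_left key hμ, ?_⟩
    rwa [Real.norm_of_nonneg (mul_nonneg (by positivity) (hφ0 x))]
  have iV : IntegrableOn (fun x => u x / ‖x‖ ^ 2 * φ x) Ω := by
    refine Integrable.mono' (i1.const_mul (r ^ (-2 : ℝ))) ?_ (hu0.mono fun x hx => (hbd x hx).2)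
    exact ((huq.1.aemeasurable.div (by fun_prop)).mul
      hcont.measurable.aemeasurable).aestronglyMeasurable
  have hle : ∫ x in Ω, (μ * (u x / ‖x‖ ^ 2 * φ x) + (u x ^ p - u x ^ q) * φ x) ≤
      ∫ x in Ω, ((K * r ^ (-(2 / (q - 1) + 2)) - s ^ q / 2 + q * s ^ (q - 1) * s / 2) * φ x -
        q * s ^ (q - 1) / 2 * (u x * φ x)) := by
    refine integral_mono_ae ((iV.const_mul μ).add ipq)
      ((iφ.const_mul _).sub (i1.const_mul _)) ?_
    filter_upwards [hu0] with x hx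
    have h1 := (hbd x hx).1
    have h2 := mul_le_mul_of_nonneg_right (hK r (u x) hr hr1 hx.le) (hφ0 x)
    have h3 := mul_le_mul_of_nonneg_right (rpow_tangent_le hq.le hpos hx.le) (hφ0 x)
    linarith
  rw [integral_add (iV.const_mul μ) ipq, integral_sub (iφ.const_mul _) (i1.const_mul _),
    integral_const_mul, integral_const_mul, integral_const_mul, hφ1, ← hs_def] at hle
  linarith

/-! ### The barrier and the Keller–Osserman estimate -/

theorem norm_add_smul_single_sq (z : 𝔼) (i : Fin N) (t : ℝ) :
    ‖z + t • EuclideanSpace.single i (1 : ℝ)‖ ^ 2 = ‖z‖ ^ 2 + 2 * t * z i + t ^ 2 := by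
  have h1 : inner ℝ z (EuclideanSpace.single i (1 : ℝ)) = z i := by
    rw [EuclideanSpace.inner_single_right]; simp
  rw [norm_add_sq_real, inner_smul_right, h1, norm_smul]
  simp
  ring

/-- Second derivative test for `v` touched from above at `x` by the barrier
`M (r² - ‖· - x₀‖²)⁻ᵃ`. -/
theorem partialDeriv_partialDeriv_le_of_touching {v : 𝔼 → ℝ} (hv : ContDiff ℝ ∞ v) {x₀ x : 𝔼}
    {r a M : ℝ} (hx : 0 < r ^ 2 - ‖x - x₀‖ ^ 2)
    (htouch : v x = M * (r ^ 2 - ‖x - x₀‖ ^ 2) ^ (-a))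
    (hle : ∀ y, 0 < r ^ 2 - ‖y - x₀‖ ^ 2 → v y ≤ M * (r ^ 2 - ‖y - x₀‖ ^ 2) ^ (-a)) (i : Fin N) :
    partialDeriv i (partialDeriv i v) x ≤
      M * (4 * a * (a + 1) * (r ^ 2 - ‖x - x₀‖ ^ 2) ^ (-(a + 2)) * (x - x₀) i ^ 2 +
        2 * a * (r ^ 2 - ‖x - x₀‖ ^ 2) ^ (-(a + 1))) := by
  set z := x - x₀ with hz
  set d := r ^ 2 - ‖z‖ ^ 2 with hd
  set g : ℝ → ℝ := fun t => d - 2 * t * z i - t ^ 2 with hg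
  have hgt : ∀ t : ℝ,
      r ^ 2 - ‖x + t • EuclideanSpace.single i (1 : ℝ) - x₀‖ ^ 2 = g t := fun t => by
    rw [add_sub_right_comm, norm_add_smul_single_sq, hg, hd]; ring
  have hg0 : g 0 = d := by simp [hg]
  have hg' : ∀ t, HasDerivAt g (-(2 * z i) - 2 * t) t := fun t => by
    have h := (((hasDerivAt_id t).const_mul 2).mul_const (z i)).const_sub d |>.sub
      (hasDerivAt_pow 2 t)
    exact h.congr_deriv (by norm_num)
  have hgpos : ∀ᶠ t in 𝓝 (0 : ℝ), 0 < g t :=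
    (hg' 0).continuousAt.eventually_mem (isOpen_Ioi.mem_nhds (by rw [hg0]; exact hx))
  have hb : ∀ (b t : ℝ), 0 < g t →
      HasDerivAt (fun t => g t ^ b) ((-(2 * z i) - 2 * t) * b * g t ^ (b - 1)) t :=
    fun b t ht => (hg' t).rpow_const (Or.inl ht.ne')
  have hmax : IsLocalMax (fun t : ℝ =>
      v (x + t • EuclideanSpace.single i (1 : ℝ)) - M * g t ^ (-a)) 0 := by
    filter_upwards [hgpos] with t ht
    have h1 := hle (x + t • EuclideanSpace.single i (1 : ℝ)) (by rw [hgt]; exact ht)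
    rw [hgt] at h1
    simp only [zero_smul, add_zero, hg0, htouch]
    linarith
  have h1 : HasDerivAt (fun t : ℝ => (-(2 * z i) - 2 * t) * (-a) * g t ^ (-a - 1))
      (4 * a * (a + 1) * d ^ (-(a + 2)) * z i ^ 2 + 2 * a * d ^ (-(a + 1))) 0 := by
    have hl : HasDerivAt (fun t : ℝ => (-(2 * z i) - 2 * t) * (-a)) (-2 * (-a)) 0 := by
      have h := (((hasDerivAt_id (0 : ℝ)).const_mul 2).const_sub (-(2 * z i))).mul_const (-a)
      simpa using h
    have h := hl.mul (hb (-a - 1) 0 (by rw [hg0]; exact hx))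
    refine h.congr_deriv ?_
    rw [hg0, show -a - 1 - 1 = -(a + 2) by ring, show -a - 1 = -(a + 1) by ring]
    ring
  have h2 := hmax.second_deriv_nonpos
    (f' := fun t => partialDeriv i v (x + t • EuclideanSpace.single i (1 : ℝ)) -
      M * ((-(2 * z i) - 2 * t) * (-a) * g t ^ (-a - 1)))
    (hgpos.mono fun t ht => (hasDerivAt_line hv i x t).sub ((hb (-a) t ht).const_mul M))
    ((hasDerivAt_line (contDiff_partialDeriv hv i) i x 0).sub (h1.const_mul M))
  simp only [zero_smul, add_zero] at h2
  linarith

/-- Interior Keller–Osserman estimate: a smooth solution of `Δv ≥ v ^ q / 2 - K r ^ (-2q/(q-1))`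
where `v > 0`, in a ball of radius `r`, is bounded at the centre whatever its boundary values are.
At the maximum of `v (r² - ‖· - x₀‖²) ^ a`, `a = 2/(q-1)`, a multiple of the barrier
`(r² - ‖· - x₀‖²) ^ (-a)`, which is infinite on the sphere, touches `v` from above. -/
theorem exists_kellerOsserman_bound (N : ℕ) {q : ℝ} (hq : 1 < q) {K : ℝ} (hK : 0 ≤ K) :
    ∃ B : ℝ, 0 < B ∧ ∀ (v : EuclideanSpace ℝ (Fin N) → ℝ) (x₀ : EuclideanSpace ℝ (Fin N)) (r : ℝ),
      ContDiff ℝ ∞ v → 0 < r →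
      (∀ x ∈ ball x₀ r, 0 < v x → v x ^ q / 2 - K * r ^ (-(2 / (q - 1) + 2)) ≤
        ∑ i, partialDeriv i (partialDeriv i v) x) →
      v x₀ ≤ B * r ^ (-(2 / (q - 1))) := by
  have hq1 : 0 < q - 1 := by linarith
  set a := 2 / (q - 1) with ha
  have ha0 : 0 < a := by positivity
  have haq : a * q = a + 2 := by rw [ha]; field_simp; ring
  set c : ℝ := 4 * a * (a + 1) + 2 * a * N with hc
  -- The power `s ^ 0 = 1` plays no role here; the bound is for `c * s + K` against `s ^ q / 2`.
  obtain ⟨L, hL, h⟩ := exists_forall_lower_order_lt hq (zero_lt_one.trans hq) c K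
  refine ⟨L, hL, fun v x₀ r hv hr hsub => ?_⟩
  by_contra! hlt
  set δ : EuclideanSpace ℝ (Fin N) → ℝ := fun x => r ^ 2 - ‖x - x₀‖ ^ 2 with hδ
  have hδball : ∀ x, 0 < δ x ↔ x ∈ ball x₀ r := fun x => by
    rw [mem_ball_iff_norm, hδ, sub_pos, sq_lt_sq₀ (norm_nonneg _) hr.le]
  have hcont : Continuous fun x => v x * δ x ^ a :=
    hv.continuous.mul ((by fun_prop : Continuous δ).rpow_const fun _ => Or.inr ha0.le)
  obtain ⟨x, hx, hmax⟩ := (isCompact_closedBall x₀ r).exists_isMaxOn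
    ⟨x₀, mem_closedBall_self hr.le⟩ hcont.continuousOn
  -- `M` is the smallest multiple of the barrier that lies above `v`; it is attained at `x`.
  set M := v x * δ x ^ a with hM
  have hδ0 : δ x₀ ^ a = r ^ a * r ^ a := by
    simp [hδ, pow_two, Real.mul_rpow hr.le hr.le]
  have hra : 0 < r ^ a := by positivity
  have hML : L * r ^ a < M := by
    have h1 : v x₀ * δ x₀ ^ a ≤ M := hmax (mem_closedBall_self hr.le)
    rw [hδ0] at h1
    rw [Real.rpow_neg hr.le, ← div_eq_mul_inv, div_lt_iff₀ hra] at hlt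
    nlinarith
  have hM0 : 0 < M := lt_trans (by positivity) hML
  have hδnn : 0 ≤ δ x := by
    rw [mem_closedBall_iff_norm] at hx
    simp only [hδ, sub_nonneg]; gcongr
  have hδx : 0 < δ x := by
    refine hδnn.lt_of_ne fun h0 => hM0.ne ?_
    rw [hM, ← h0, Real.zero_rpow ha0.ne', mul_zero]
  have htouch : v x = M * δ x ^ (-a) := by
    rw [hM, mul_assoc, ← Real.rpow_add hδx]; simp
  have hle : ∀ y, 0 < δ y → v y ≤ M * δ y ^ (-a) := fun y hy => by
    have h1 : v y * δ y ^ a ≤ M := hmax (ball_subset_closedBall ((hδball y).1 hy))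
    rwa [Real.rpow_neg hy.le, ← div_eq_mul_inv, le_div_iff₀ (by positivity)]
  have hvx : 0 < v x := by rw [htouch]; positivity
  have h1 := hsub x ((hδball x).1 hδx) hvx
  have h2 := Finset.sum_le_sum fun i (_ : i ∈ Finset.univ) =>
    partialDeriv_partialDeriv_le_of_touching hv hδx htouch hle i
  have hnorm : ∑ i, (x - x₀) i ^ 2 = ‖x - x₀‖ ^ 2 := by
    rw [EuclideanSpace.norm_sq_eq]; simp
  rw [← Finset.mul_sum, Finset.sum_add_distrib, ← Finset.mul_sum, hnorm] at h2
  change _ ≤ M * (4 * a * (a + 1) * δ x ^ (-(a + 2)) * ‖x - x₀‖ ^ 2 +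
    ∑ _i : Fin N, 2 * a * δ x ^ (-(a + 1))) at h2
  have hδr : δ x ≤ r ^ 2 := by simp only [hδ]; linarith [sq_nonneg ‖x - x₀‖]
  have hzr : ‖x - x₀‖ ^ 2 ≤ r ^ 2 := by simp only [hδ] at hδx; linarith
  have e1 : δ x ^ (-(a + 1)) = δ x ^ (-(a + 2)) * δ x := by
    rw [← Real.rpow_add_one hδx.ne']; ring_nf
  have e2 : v x ^ q = M ^ q * δ x ^ (-(a + 2)) := by
    rw [htouch, Real.mul_rpow hM0.le (by positivity), ← Real.rpow_mul hδx.le, ← haq]; ring_nf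
  set P := δ x ^ (-(a + 2)) with hP
  have hP0 : 0 < P := by positivity
  have h3 : M * (4 * a * (a + 1) * P * ‖x - x₀‖ ^ 2 + ∑ _i : Fin N, 2 * a * δ x ^ (-(a + 1))) ≤
      c * (M * r ^ 2) * P := by
    have : 4 * a * (a + 1) * P * ‖x - x₀‖ ^ 2 + ∑ _i : Fin N, 2 * a * δ x ^ (-(a + 1)) ≤
        4 * a * (a + 1) * P * r ^ 2 + N * (2 * a * (P * r ^ 2)) := by
      simp only [Finset.sum_const, Finset.card_univ, Fintype.card_fin, nsmul_eq_mul, e1]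
      gcongr
    refine (mul_le_mul_of_nonneg_left this hM0.le).trans (le_of_eq ?_)
    rw [hc]; ring
  have e3 : r ^ (-(a + 2)) ≤ r ^ (a + 2) * P := by
    have h5 : (r ^ 2) ^ (-(a + 2)) ≤ P :=
      Real.rpow_le_rpow_of_nonpos hδx hδr (by linarith)
    calc r ^ (-(a + 2)) = r ^ (a + 2) * (r ^ 2) ^ (-(a + 2)) := by
          rw [← Real.rpow_natCast, ← Real.rpow_mul hr.le, ← Real.rpow_add hr]
          congr 1; push_cast; ring
      _ ≤ _ := by gcongr
  -- After division by `P` and rescaling, the touching inequality is one about `S = M r⁻ᵃ`.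
  obtain ⟨S, hS⟩ : ∃ S, M = S * r ^ a := ⟨M / r ^ a, by field_simp⟩
  have hSL : L < S := by rw [hS] at hML; exact lt_of_mul_lt_mul_right hML hra.le
  have e4 : M ^ q = S ^ q * r ^ (a + 2) := by
    rw [hS, Real.mul_rpow (hL.trans hSL).le hra.le, ← Real.rpow_mul hr.le, haq]
  have e5 : M * r ^ 2 = S * r ^ (a + 2) := by
    rw [hS, mul_assoc, Real.rpow_add hr, Real.rpow_two]
  have hr2 : 0 < r ^ (a + 2) := by positivity
  rw [e2, e4] at h1
  rw [e5] at h3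
  have h6 : (S ^ q / 2) * (r ^ (a + 2) * P) ≤ (K + c * S) * (r ^ (a + 2) * P) := by
    have := mul_le_mul_of_nonneg_left e3 hK
    linarith
  have h7 := le_of_mul_le_mul_right h6 (by positivity)
  have h8 := h S hSL.le
  rw [Real.rpow_zero] at h8
  linarith

/-! ### Mollification and passage to the limit -/

open scoped Convolution in
theorem convolution_indicator_eq (Ω : Opens 𝔼) (u f : 𝔼 → ℝ) (y : 𝔼) :
    (f ⋆[ContinuousLinearMap.lsmul ℝ ℝ, volume] (Ω : Set 𝔼).indicator u) y =
      ∫ x in Ω, u x * f (y - x) := by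
  rw [convolution_lsmul_swap, ← integral_indicator Ω.isOpen.measurableSet]
  congr 1; funext x
  by_cases hx : x ∈ (Ω : Set 𝔼) <;> simp [hx, mul_comm]

open scoped Convolution in
/-- The mollification `v` of a solution is a classical subsolution, at all points `y` around which
the support of the mollifier fits into `Ω` and keeps the distance `r` from the origin. -/
theorem IsSolution.laplacian_mollification_ge {μ p q K r : ℝ} {Ω : Opens 𝔼} {u : 𝔼 → ℝ}
    (hsol : IsSolution μ p q Ω u) (hμ : 0 ≤ μ) (hp : 0 ≤ p) (hq : 1 < q) (hpq : p < q)
    (hr : 0 < r) (hr1 : r ≤ 1)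
    (hK : ∀ r t : ℝ, 0 < r → r ≤ 1 → 0 ≤ t →
      μ * r ^ (-2 : ℝ) * t + (t ^ p - t ^ q) ≤ K * r ^ (-(2 / (q - 1) + 2)) - t ^ q / 2)
    (η : ContDiffBump (0 : 𝔼)) {y : 𝔼} (hΩ : closedBall y η.rOut ⊆ Ω)
    (hfar : ∀ x ∈ closedBall y η.rOut, r ≤ ‖x‖) {v : 𝔼 → ℝ}
    (hv : v = η.normed volume ⋆[ContinuousLinearMap.lsmul ℝ ℝ, volume] (Ω : Set 𝔼).indicator u)
    (hvy : 0 < v y) :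
    v y ^ q / 2 - K * r ^ (-(2 / (q - 1) + 2)) ≤ ∑ i, partialDeriv i (partialDeriv i v) y := by
  have hU : LocallyIntegrable ((Ω : Set 𝔼).indicator u) := by
    obtain ⟨-, -, G, ⟨⟨hu2, -⟩, -⟩, -⟩ := hsol
    exact ((memLp_indicator_iff_restrict Ω.isOpen.measurableSet).2 hu2).locallyIntegrable
      one_le_two
  have hη : ContDiff ℝ ∞ (η.normed volume) := η.contDiff_normed
  have hηc : HasCompactSupport (η.normed volume) := η.hasCompactSupport_normed
  have hφ : ContDiff ℝ ∞ fun x => η.normed volume (y - x) :=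
    hη.comp (contDiff_const.sub contDiff_id)
  have hts : tsupport (fun x => η.normed volume (y - x)) ⊆ closedBall y η.rOut := by
    refine closure_minimal (fun x hx => ?_) isClosed_closedBall
    have : y - x ∈ Function.support (η.normed volume) := hx
    rw [η.support_normed_eq, mem_ball_zero_iff] at this
    rw [mem_closedBall_iff_norm']
    exact this.le
  have hφc : HasCompactSupport fun x => η.normed volume (y - x) :=
    (isCompact_closedBall y η.rOut).of_isClosed_subset (isClosed_tsupport _) hts
  have hφ1 : ∫ x in Ω, η.normed volume (y - x) = 1 := by
    rw [setIntegral_eq_integral_of_forall_compl_eq_zero fun x hx => ?_,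
      integral_sub_left_eq_self (fun x => η.normed volume x), η.integral_normed]
    exact image_eq_zero_of_notMem_tsupport (f := fun x => η.normed volume (y - x))
      fun h => hx (hΩ (hts h))
  have hvy' : v y = ∫ x in Ω, u x * η.normed volume (y - x) := by
    rw [hv, convolution_indicator_eq]
  have h := hsol.le_integral_mul_laplacian hμ hp hq hpq hr hr1 hK hφ hφc (hts.trans hΩ)
    (fun x => η.nonneg_normed _) (fun x hx => hfar x (hts hx)) hφ1 (by rwa [← hvy'])
  rw [← hvy'] at h
  refine h.trans (le_of_eq (Finset.sum_congr rfl fun i _ => ?_))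
  rw [hv, partialDeriv_convolution hη hηc hU, partialDeriv_convolution (contDiff_partialDeriv hη i)
    (hasCompactSupport_partialDeriv hηc i) hU, convolution_indicator_eq,
    partialDeriv_partialDeriv_comp_sub_left hη]

/-- The almost everywhere bound. The point `x₀ = 0` is excluded because the real power makes the
right-hand side vanish there. -/
theorem exists_ae_bound (N : ℕ) {μ p q : ℝ} (hμ : 0 ≤ μ) (hp : 0 ≤ p) (hq : 1 < q) (hpq : p < q) :
    ∃ C : ℝ, 0 < C ∧ ∀ (R : ℝ) (Ω : Opens (EuclideanSpace ℝ (Fin N)))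
      (u : EuclideanSpace ℝ (Fin N) → ℝ), ball 0 R ⊆ (Ω : Set (EuclideanSpace ℝ (Fin N))) →
      IsSolution μ p q Ω u → ∀ᵐ x : EuclideanSpace ℝ (Fin N), x ∈ ball 0 (min (R / 2) 1) → x ≠ 0 →
        u x ≤ C * ‖x‖ ^ (-(2 / (q - 1))) := by
  obtain ⟨K, hK0, hK⟩ := exists_absorption_const hp hq hpq hμ
  obtain ⟨B, hB, hbound⟩ := exists_kellerOsserman_bound N hq hK0
  refine ⟨B * 4 ^ (2 / (q - 1)), by positivity, fun R Ω u hΩ hsol => ?_⟩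
  have hU : LocallyIntegrable ((Ω : Set (EuclideanSpace ℝ (Fin N))).indicator u) := by
    obtain ⟨-, -, G, ⟨⟨hu2, -⟩, -⟩, -⟩ := hsol
    exact ((memLp_indicator_iff_restrict Ω.isOpen.measurableSet).2 hu2).locallyIntegrable
      one_le_two
  let η : ℕ → ContDiffBump (0 : EuclideanSpace ℝ (Fin N)) := fun n =>
    ⟨1 / ((n : ℝ) + 1), 2 * (1 / ((n : ℝ) + 1)), by positivity,
      lt_mul_of_one_lt_left (by positivity) one_lt_two⟩
  have hηlim : Tendsto (fun n => (η n).rOut) atTop (𝓝 0) := by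
    have h := (tendsto_one_div_add_atTop_nhds_zero_nat (𝕜 := ℝ)).const_mul 2
    rw [mul_zero] at h
    exact h
  filter_upwards [ContDiffBump.ae_convolution_tendsto_right_of_locallyIntegrable (K := 2) hηlim
    (Eventually.of_forall fun n => le_rfl) hU] with x₀ hlim hx₀ hne
  rw [mem_ball_zero_iff, lt_min_iff] at hx₀
  -- Radius `r` for the Keller–Osserman ball, and another `r` for the support of the mollifier,
  -- leave a distance `2 * r ≥ r` to the origin.
  set r := ‖x₀‖ / 4 with hr_def
  have hr : 0 < r := by have := norm_pos_iff.2 hne; positivity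
  have hball : ∀ x ∈ ball x₀ (2 * r), x ∈ Ω ∧ r ≤ ‖x‖ := fun x hx => by
    rw [mem_ball_iff_norm] at hx
    have h1 := norm_le_norm_add_norm_sub' x x₀
    have h2 := norm_le_norm_add_norm_sub x x₀
    refine ⟨hΩ ?_, by linarith⟩
    rw [mem_ball_zero_iff]; linarith
  have hx₀Ω : x₀ ∈ (Ω : Set (EuclideanSpace ℝ (Fin N))) :=
    (hball x₀ (mem_ball_self (by positivity))).1
  rw [Set.indicator_of_mem hx₀Ω] at hlim
  have hrpow : B * 4 ^ (2 / (q - 1)) * ‖x₀‖ ^ (-(2 / (q - 1))) = B * r ^ (-(2 / (q - 1))) := by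
    rw [hr_def, Real.div_rpow (norm_nonneg _) (by norm_num), Real.rpow_neg (by norm_num) _,
      Real.rpow_neg (by norm_num : (0 : ℝ) ≤ 4) _]
    field_simp
  rw [hrpow]
  refine le_of_tendsto hlim ?_
  filter_upwards [hηlim.eventually (gt_mem_nhds hr)] with n hn
  refine hbound _ x₀ r ?_ hr fun y hy hvy => ?_
  · exact (η n).hasCompactSupport_normed.contDiff_convolution_left _ (η n).contDiff_normed hU
  · have hsub : closedBall y (η n).rOut ⊆ ball x₀ (2 * r) :=
      closedBall_subset_ball' (by rw [mem_ball] at hy; linarith)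
    exact hsol.laplacian_mollification_ge hμ hp hq hpq hr (by linarith) hK (η n)
      (fun x hx => (hball x (hsub hx)).1) (fun x hx => (hball x (hsub hx)).2) rfl hvy

/-- An almost everywhere inequality between continuous functions on an open set holds throughout. -/
theorem le_of_ae_le_of_continuousOn {f g : 𝔼 → ℝ} {s : Set 𝔼} (hs : IsOpen s)
    (hf : ContinuousOn f s) (hg : ContinuousOn g s) (h : ∀ᵐ x, x ∈ s → f x ≤ g x) :
    ∀ x ∈ s, f x ≤ g x := by
  intro x hx
  by_contra! hlt
  have hopen : IsOpen (s ∩ (fun x => f x - g x) ⁻¹' Set.Ioi 0) :=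
    (hf.sub hg).isOpen_inter_preimage hs isOpen_Ioi
  have hpos := hopen.measure_pos volume ⟨x, hx, sub_pos.2 hlt⟩
  have hsub : s ∩ (fun x => f x - g x) ⁻¹' Set.Ioi 0 ⊆ {x | ¬(x ∈ s → f x ≤ g x)} :=
    fun y hy hle => (sub_pos.1 hy.2).not_ge (hle hy.1)
  exact hpos.ne' (measure_mono_null hsub (ae_iff.1 h))

end HardyProblem

theorem theoremt (N : ℕ) (hN : 3 ≤ N) (μ : ℝ) (hμ_pos : 0 < μ) (hμ_lt : μ < HardyProblem.muBar N)
    (p q : ℝ) (hp : ((N : ℝ) + 2) / ((N : ℝ) - 2) ≤ p)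
    (hq : max p ((2 + HardyProblem.nu N μ) / HardyProblem.nu N μ) < q)
    (R : ℝ) (hR : 0 < R) :
    ∃ ρ : ℝ, 0 < ρ ∧ ∃ C : ℝ, 0 < C ∧
      ∀ Ω : TopologicalSpace.Opens (EuclideanSpace ℝ (Fin N)),
        HardyProblem.IsSmoothDomain Ω →
        Metric.ball (0 : EuclideanSpace ℝ (Fin N)) R ⊆ Ω →
        ∀ u : EuclideanSpace ℝ (Fin N) → ℝ, HardyProblem.IsSolution μ p q Ω u →
          (∀ᵐ x : EuclideanSpace ℝ (Fin N),
            x ∈ Metric.ball (0 : EuclideanSpace ℝ (Fin N)) ρ →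
              u x ≤ C * ‖x‖ ^ (-(2 / (q - 1)))) ∧
          (ContinuousOn u ((Ω : Set (EuclideanSpace ℝ (Fin N))) \ {0}) →
            ∀ x ∈ Metric.ball (0 : EuclideanSpace ℝ (Fin N)) ρ \ {0},
              u x ≤ C * ‖x‖ ^ (-(2 / (q - 1)))) := by
  have hN' : (3 : ℝ) ≤ N := by exact_mod_cast hN
  have hp1 : 1 < p := by
    refine lt_of_lt_of_le ?_ hp
    rw [one_lt_div (by linarith)]; linarith
  have hpq : p < q := (le_max_left _ _).trans_lt hq
  obtain ⟨C, hC, hbound⟩ := HardyProblem.exists_ae_bound N hμ_pos.le (zero_le_one.trans hp1.le)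
    (hp1.trans hpq) hpq
  refine ⟨min (R / 2) 1, by positivity, C, hC, fun Ω _ hΩ u hu => ?_⟩
  have hae := hbound R Ω u hΩ hu
  refine ⟨?_, fun hcont => ?_⟩
  · have : Nontrivial (EuclideanSpace ℝ (Fin N)) :=
      Module.nontrivial_of_finrank_pos (R := ℝ) (by rw [finrank_euclideanSpace_fin]; omega)
    filter_upwards [hae, Measure.ae_ne volume (0 : EuclideanSpace ℝ (Fin N))] with x hx hne hxb
    exact hx hxb hne
  · refine HardyProblem.le_of_ae_le_of_continuousOn (Metric.isOpen_ball.sdiff isClosed_singleton)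
      (hcont.mono fun x hx => ⟨hΩ ?_, hx.2⟩) ?_ (hae.mono fun x hx hxm => hx hxm.1 hxm.2)
    · exact Metric.ball_subset_ball ((min_le_left _ _).trans (by linarith)) hx.1
    · exact continuousOn_const.mul
        (continuous_norm.continuousOn.rpow_const fun x hx => Or.inl (norm_ne_zero_iff.2 hx.2))
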